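/- Let $S$ (states) and $A$ (actions) be Borel spaces, i.e. non-empty Borel subsets of complete separable metric spaces. For each $s\in S$ let $A(s)\subset A$ be a non-empty set such that $\mathbb K=\{(s,a): s\in S,\ a\in A(s)\}$ is Borel in $S\times A$. Let $p$ be a transition probability from $\mathbb K$ to $S$, $\mu$ a probability measure on $S$, $\beta\in(0,1)$, and let $r_0,\dots,r_m:\mathbb K\to[-\infty,\infty)$ be Borel measurable. A policy $\pi=(\pi_n)_{n\ge1}$ is a sequence of transition probabilities $\pi_n$ from the set $H_n=\mathbb K^{n-1}\times S$ of histories $h_n=(s_1,a_1,\dots,s_{n-1},a_{n-1},s_n)$ to $A$ with $\pi_n(A(s_n)\mid h_n)=1$ for all $h_n\in H_n$; $\Pi$ is the set of all policies. For $\pi\in\Pi$ let $P^\pi_\mu$ be the strategic measure on $\Omega=(S\times A)^\infty$, i.e. the law of $(s_1,a_1,s_2,a_2,\dots)$ under which $s_1$ has law $\mu$, the conditional law of $a_n$ given $h_n$ is $\pi_n(\cdot\mid h_n)$, and the conditional law of $s_{n+1}$ given $(h_n,a_n)$ is $p(\cdot\mid s_n,a_n)$; it is carried by $\mathbb K^\infty$,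 and $E^\pi_\mu$ denotes its expectation. Let $\mathcal P=\{P^\pi_\mu:\pi\in\Pi\}$ carry the topology of weak convergence of probability measures on $\Omega$. Assume that there is a Borel function $w:S\to[1,\infty)$ with (A1) $r_i(s,a)\le w(s)$ for all $(s,a)\in\mathbb K$ and $i=0,\dots,m$; (A2) $\displaystyle\lim_{n\to\infty}\sup_{\pi\in\Pi}E^\pi_\mu\Big(\sum_{k=n}^\infty\beta^{k-1}w(s_k)\Big)=0$, and $\displaystyle\lim_{l\to\infty}\sup_{\pi\in\Pi}E^\pi_\mu\big(w(s_n)1_{\{w(s_n)\ge l\}}\big)=0$ for every $n\ge1$; and that either (W1)–(W3) or (S1)–(S3) hold: (W1) every $A(s)$ is compact, and $\{s: A(s)\cap B\neq\emptyset\}$ is closed for every closed $B\subset A$; (W2) $(s,a)\mapsto\int_S v(t)\,p(dt\mid s,a)$ is continuous on $\mathbb K$ for every bounded continuous $v:S\to\mathbb R$; (W3) every $r_i$ is upper semicontinuous on $\mathbb K$; (S1) every $A(s)$ is compact; (S2) $a\mapsto p(D\mid s,a)$ is continuous on $A(s)$ for every $s\in S$ and every Borel $D\subset S$; (S3) $r_i(s,\cdot)$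 is upper semicontinuous on $A(s)$ for every $i$ and $s$. Then, for every $i\in\{0,\dots,m\}$, the discounted reward functional $$J_i(P^\pi_\mu)=E^\pi_\mu\Big(\sum_{n=1}^\infty\beta^{n-1}r_i(s_n,a_n)\Big)$$ is well defined on $\mathcal P$ with values in $[-\infty,\infty)$ (indeed $E^\pi_\mu\big(\sum_{n=1}^\infty\beta^{n-1}\max\{r_i(s_n,a_n),0\}\big)<\infty$ for every $\pi\in\Pi$), and $J_i:\mathcal P\to[-\infty,\infty)$ is upper semicontinuous. -/

import Mathlib

open MeasureTheory ProbabilityTheory Filter Topology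
open scoped ENNReal BoundedContinuousFunction

universe u v

/-- A Borel space: a nonempty topological space that is (homeomorphic to) a Borel subset of a
complete separable metric space, with its Borel sigma-algebra. -/
class BorelSubspaceOfPolish (Y : Type u) [TopologicalSpace Y] [MeasurableSpace Y] : Prop
    extends BorelSpace Y where
  nonempty : Nonempty Y
  exists_embedding : ∃ (Z : Type u) (_ : TopologicalSpace Z) (_ : PolishSpace Z) (f : Y → Z),
    IsEmbedding f ∧ MeasurableSet[borel Z] (Set.range f)

/-- Second countability is needed for the Borel sigma-algebra of a countable product of Borel
spaces to be the product sigma-algebra. -/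
instance BorelSubspaceOfPolish.secondCountableTopology (Y : Type u) [TopologicalSpace Y]
    [MeasurableSpace Y] [h : BorelSubspaceOfPolish Y] : SecondCountableTopology Y := by
  obtain ⟨Z, _, _, f, hf, _⟩ := h.exists_embedding
  exact hf.secondCountableTopology

noncomputable section

/-- A constrained Markov decision process with state space `S`, action space `A`, and reward
functions `r 0, …, r m` (`r 0` is the stage reward, the others are the sources of constraints). -/
structure CMDP (S : Type u) (A : Type v) [MeasurableSpace S] [MeasurableSpace A] (m : ℕ) where
  /-- the set of actions available in a state -/
  act : S → Set A
  act_nonempty : ∀ s, (act s).Nonempty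
  measurableSet_graph : MeasurableSet {x : S × A | x.2 ∈ act x.1}
  /-- the transition probability from feasible state-action pairs to states -/
  p : Kernel {x : S × A // x.2 ∈ act x.1} S
  isMarkovKernel_p : IsMarkovKernel p
  /-- the initial distribution -/
  μ : Measure S
  isProbabilityMeasure_μ : IsProbabilityMeasure μ
  /-- the reward functions, with values in `[-∞, ∞)` -/
  r : Fin (m + 1) → {x : S × A // x.2 ∈ act x.1} → EReal
  measurable_r : ∀ i, Measurable (r i)
  r_ne_top : ∀ i k, r i k ≠ ⊤
  /-- the discount factor -/
  β : ℝ
  β_pos : 0 < β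
  β_lt_one : β < 1

namespace CMDP

section Measurable

variable {S : Type u} {A : Type v} [MeasurableSpace S] [MeasurableSpace A] {m : ℕ}

/-- The space of feasible state-action pairs. -/
abbrev K (M : CMDP S A m) : Type (max u v) := {x : S × A // x.2 ∈ M.act x.1}

/-- The space of partial histories `(s₀, a₀, …, s_{n-1}, a_{n-1}, s_n)`; time starts at `0`. -/
abbrev H (M : CMDP S A m) (n : ℕ) : Type (max u v) := (Fin n → M.K) × S

/-- A (randomized, history dependent) policy. -/
structure Policy (M : CMDP S A m) where
  /-- the conditional distribution of the action `a_n` given the partial history -/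
  kernel : ∀ n, Kernel (M.H n) A
  isMarkovKernel : ∀ n, IsMarkovKernel (kernel n)
  feasible : ∀ n (h : M.H n), kernel n h (M.act h.2) = 1

/-- The first `n` state-action pairs of a feasible trajectory. -/
def past (M : CMDP S A m) (n : ℕ) (ω : ℕ → M.K) : Fin n → M.K := fun i => ω i

/-- The partial history of a feasible trajectory at time `n`. -/
def hist (M : CMDP S A m) (n : ℕ) (ω : ℕ → M.K) : M.H n := (M.past n ω, (ω n).1.1)

/-- `Q` is the law on the space of feasible trajectories under the policy `π`:
`s₀` has law `μ`, the conditional law of `a_n` given the history `h_n` is `π_n(· | h_n)`, and the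
conditional law of `s_{n+1}` given `(h_n, a_n)` is `p(· | s_n, a_n)`. -/
structure IsTrajectoryLaw (M : CMDP S A m) (π : M.Policy) (Q : Measure (ℕ → M.K)) : Prop where
  initial : Q.map (fun ω => (ω 0).1.1) = M.μ
  action : ∀ n, Q.map (fun ω => (M.hist n ω, (ω n).1.2)) = (Q.map (M.hist n)) ⊗ₘ (π.kernel n)
  transition : ∀ n, Q.map (fun ω => (M.past (n + 1) ω, (ω (n + 1)).1.1)) =
    (Q.map (M.past (n + 1))) ⊗ₘ
      (M.p.comap (fun k : Fin (n + 1) → M.K => k (Fin.last n)) (measurable_pi_apply _))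

/-- `P` is the strategic measure on `(S × A)^∞` of the policy `π` (and the initial distribution):
it is the image of the law on feasible trajectories. -/
def IsStrategicMeasure (M : CMDP S A m) (π : M.Policy)
    (P : ProbabilityMeasure (ℕ → S × A)) : Prop :=
  ∃ Q : Measure (ℕ → M.K), M.IsTrajectoryLaw π Q ∧
    (P : Measure (ℕ → S × A)) = Q.map (fun ω n => (ω n).1)

/-- The set of all strategic measures. -/
def strategicMeasures (M : CMDP S A m) : Set (ProbabilityMeasure (ℕ → S × A)) :=
  {P | ∃ π : M.Policy, M.IsStrategicMeasure π P}

open Classical in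
/-- The reward function as a function on `S × A`. The value `0` at infeasible pairs is immaterial,
because strategic measures are carried by feasible trajectories. -/
def reward (M : CMDP S A m) (i : Fin (m + 1)) (x : S × A) : EReal :=
  if h : x.2 ∈ M.act x.1 then M.r i ⟨x, h⟩ else 0

/-- The expectation of an extended real function: the difference of the expectations of its
positive and its negative part (it is well defined if one of them is finite). -/
def expect {Ω : Type*} [MeasurableSpace Ω] (P : Measure Ω) (f : Ω → EReal) : EReal :=
  ((∫⁻ ω, (f ω).toENNReal ∂P : ℝ≥0∞) : EReal) - ((∫⁻ ω, (-f ω).toENNReal ∂P : ℝ≥0∞) : EReal)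

/-- The expected total discounted reward `J_i`, as a function of the strategic measure. -/
def J (M : CMDP S A m) (i : Fin (m + 1)) (P : ProbabilityMeasure (ℕ → S × A)) : EReal :=
  expect (P : Measure (ℕ → S × A))
    (fun ω => ∑' n : ℕ, ((M.β ^ n : ℝ) : EReal) * M.reward i (ω n))

/-- The expected total discounted positive part of the reward. -/
def Jpos (M : CMDP S A m) (i : Fin (m + 1)) (P : ProbabilityMeasure (ℕ → S × A)) : ℝ≥0∞ :=
  ∫⁻ ω, ∑' n : ℕ, ENNReal.ofReal (M.β ^ n) * (M.reward i (ω n)).toENNReal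
    ∂(P : Measure (ℕ → S × A))

/-- `w` is a Borel function with values in `[1, ∞)` and dominates the rewards from above. -/
structure IsUpperBound (M : CMDP S A m) (w : S → ℝ) : Prop where
  measurable : Measurable w
  one_le : ∀ s, 1 ≤ w s
  r_le : ∀ i (k : M.K), M.r i k ≤ (w k.1.1 : EReal)

/-- The expected discounted tails of `w` tend to zero uniformly over all policies, and `w(s_n)` is
uniformly integrable with respect to the strategic measures, for every `n`. -/
structure UniformlyIntegrable (M : CMDP S A m) (w : S → ℝ) : Prop where
  tail : Tendsto (fun n : ℕ => ⨆ P ∈ M.strategicMeasures,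
    ∫⁻ ω, ∑' k : ℕ, ENNReal.ofReal (M.β ^ (n + k) * w (ω (n + k)).1)
      ∂(P : Measure (ℕ → S × A))) atTop (𝓝 0)
  unifInt : ∀ n : ℕ, Tendsto (fun l : ℕ => ⨆ P ∈ M.strategicMeasures,
    ∫⁻ ω, ({s : S | (l : ℝ) ≤ w s}.indicator (fun s => ENNReal.ofReal (w s))) (ω n).1
      ∂(P : Measure (ℕ → S × A))) atTop (𝓝 0)

end Measurable

section Topological

variable {S : Type u} {A : Type v} [MeasurableSpace S] [MeasurableSpace A]
  [TopologicalSpace S] [TopologicalSpace A] {m : ℕ}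

/-- Model with weakly continuous transitions. -/
structure IsWeaklyContinuous (M : CMDP S A m) : Prop where
  isCompact_act : ∀ s, IsCompact (M.act s)
  /-- upper semicontinuity of the correspondence of available actions -/
  isClosed_act : ∀ B : Set A, IsClosed B → IsClosed {s | (M.act s ∩ B).Nonempty}
  continuous_p : ∀ f : S →ᵇ ℝ, Continuous (fun k : M.K => ∫ t, f t ∂(M.p k))
  usc_r : ∀ i, UpperSemicontinuous (M.r i)

/-- Model with setwise continuous transitions. -/
structure IsSetwiseContinuous (M : CMDP S A m) : Prop where
  isCompact_act : ∀ s, IsCompact (M.act s)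
  continuous_p : ∀ (s : S) (D : Set S), MeasurableSet D →
    Continuous (fun a : M.act s => M.p ⟨(s, a.1), a.2⟩ D)
  usc_r : ∀ i (s : S), UpperSemicontinuous (fun a : M.act s => M.r i ⟨(s, a.1), a.2⟩)

end Topological

end CMDP

end

/-! Fix a level `l`. Pointwise r = l + (r - l)⁺ - (l - r)⁺, so with L = l · ∑ βⁿ the discounted
reward is J = L + `excess` - `shortfall`. By (A1) the excess is dominated by the large values of
`w`, so (A2) makes it small uniformly over all policies once `l` is large
(`UniformlyIntegrable.exists_excess_le`). The shortfall integrates a nonnegative function that is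
lower semicontinuous where r is upper semicontinuous, and it is sequentially lower semicontinuous in
the strategic measure (`shortfall_le_liminf`). Hence J is upper semicontinuous up to an arbitrarily
small error.

By Fatou's lemma, applied to the sum over time and to the layer cake formula, the claim about the
shortfall reduces to a portmanteau inequality for superlevel sets under the law of (s_n, a_n). In
the weakly continuous model the graph of feasible pairs is closed; the integrand, set to ∞ off the
graph, then has open superlevel sets. In the setwise continuous model only their sections in A are
open. That suffices because the laws of s_n converge setwise (`tendsto_pairLaw_fst`), and open
sections together with setwise convergent marginals still give the inequality
(`le_liminf_measure_of_isOpen_section`). -/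

namespace MeasureTheory

/-! ### Layer cake formula and portmanteau inequalities on products. -/

theorem volume_Ioi_inter_ofReal_lt (c : ℝ≥0∞) :
    volume ({t : ℝ | ENNReal.ofReal t < c} ∩ Set.Ioi 0) = c := by
  rcases eq_or_ne c ⊤ with rfl | hc
  · have : ({t : ℝ | ENNReal.ofReal t < ⊤} ∩ Set.Ioi 0) = Set.Ioi 0 := by
      ext t; simp
    rw [this, Real.volume_Ioi]
  · have : ({t : ℝ | ENNReal.ofReal t < c} ∩ Set.Ioi 0) = Set.Ioo 0 c.toReal := by
      ext t
      simp only [Set.mem_inter_iff, Set.mem_ofPred_eq, Set.mem_Ioi, Set.mem_Ioo]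
      constructor
      · rintro ⟨h1, h2⟩
        exact ⟨h2, (ENNReal.ofReal_lt_iff_lt_toReal h2.le hc).1 h1⟩
      · rintro ⟨h1, h2⟩
        exact ⟨(ENNReal.ofReal_lt_iff_lt_toReal h1.le hc).2 h2, h1⟩
    rw [this, Real.volume_Ioo, sub_zero, ENNReal.ofReal_toReal hc]

/-- The layer cake formula for functions with values in `[0, ∞]`. -/
theorem lintegral_eq_lintegral_measure_ofReal_lt {α : Type*} [MeasurableSpace α] (μ : Measure α)
    [SFinite μ] {g : α → ℝ≥0∞} (hg : Measurable g) :
    ∫⁻ x, g x ∂μ = ∫⁻ t in Set.Ioi (0 : ℝ), μ {x | ENNReal.ofReal t < g x} := by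
  have hm : MeasurableSet {y : α × ℝ | ENNReal.ofReal y.2 < g y.1} :=
    measurableSet_lt (by fun_prop) (by fun_prop)
  have h1 : ∀ x, g x = ∫⁻ t in Set.Ioi (0 : ℝ),
      {y : α × ℝ | ENNReal.ofReal y.2 < g y.1}.indicator 1 (x, t) := by
    intro x
    have h2 : (fun t : ℝ => {y : α × ℝ | ENNReal.ofReal y.2 < g y.1}.indicator
        (1 : α × ℝ → ℝ≥0∞) (x, t)) = {t : ℝ | ENNReal.ofReal t < g x}.indicator 1 := by
      ext t; simp [Set.indicator]
    have h3 : MeasurableSet {t : ℝ | ENNReal.ofReal t < g x} :=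
      measurableSet_lt (by fun_prop) (by fun_prop)
    rw [h2, lintegral_indicator_one h3, Measure.restrict_apply h3, volume_Ioi_inter_ofReal_lt]
  rw [lintegral_congr h1, lintegral_lintegral_swap]
  · refine lintegral_congr fun t => ?_
    have h2 : (fun x : α => {y : α × ℝ | ENNReal.ofReal y.2 < g y.1}.indicator
        (1 : α × ℝ → ℝ≥0∞) (x, t)) = {x : α | ENNReal.ofReal t < g x}.indicator 1 := by
      ext t; simp [Set.indicator]
    rw [h2, lintegral_indicator_one (measurableSet_lt (by fun_prop) hg)]
  · exact (measurable_one.indicator hm).aemeasurable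

/-- If the measures of all superlevel sets of `g` are lower semicontinuous along a sequence of
measures, then so is the integral of `g`. -/
theorem lintegral_le_liminf_of_measure_superlevel_le {α : Type*} [MeasurableSpace α]
    {μ : Measure α} [SFinite μ] {μs : ℕ → Measure α} [∀ n, SFinite (μs n)]
    {g : α → ℝ≥0∞} (hg : Measurable g)
    (h : ∀ t, μ {x | t < g x} ≤ liminf (fun n => μs n {x | t < g x}) atTop) :
    ∫⁻ x, g x ∂μ ≤ liminf (fun n => ∫⁻ x, g x ∂(μs n)) atTop := by
  simp_rw [lintegral_eq_lintegral_measure_ofReal_lt _ hg]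
  -- Fatou in the level variable t; the integrands are measurable because they are antitone in t.
  refine (lintegral_mono fun t => h (ENNReal.ofReal t)).trans (lintegral_liminf_le fun n => ?_)
  have : Antitone fun t : ℝ => μs n {x | ENNReal.ofReal t < g x} := fun s t hst =>
    measure_mono fun x (hx : _ < _) => (ENNReal.ofReal_le_ofReal hst).trans_lt hx
  exact this.measurable

/-- A measurable set with open sections is, up to a null set, a countable union of measurable
rectangles with open second factors. -/
theorem exists_ae_eq_iUnion_prod_of_isOpen_section {S A : Type*} [MeasurableSpace S]
    [TopologicalSpace A] [SecondCountableTopology A] [MeasurableSpace A] [OpensMeasurableSpace A]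
    [StandardBorelSpace A] [Nonempty A] (R : Measure (S × A)) [IsFiniteMeasure R]
    {O : Set (S × A)} (hO : MeasurableSet O) (hsec : ∀ s, IsOpen {a | (s, a) ∈ O}) :
    ∃ (E : ℕ → Set S) (B : ℕ → Set A), (∀ j, MeasurableSet (E j)) ∧ (∀ j, IsOpen (B j)) ∧
      O ⊆ ⋃ j, E j ×ˢ B j ∧ R ((⋃ j, E j ×ˢ B j) \ O) = 0 := by
  obtain ⟨B, hBr⟩ := (TopologicalSpace.countable_countableBasis A).exists_eq_range
    (((TopologicalSpace.isBasis_countableBasis A).exists_subset_of_mem_open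
      (Set.mem_univ (Classical.arbitrary A)) isOpen_univ).imp fun _ h => h.1)
  have hB : TopologicalSpace.IsTopologicalBasis (Set.range B) :=
    hBr ▸ TopologicalSpace.isBasis_countableBasis A
  have hBo : ∀ j, IsOpen (B j) := fun j => hB.isOpen ⟨j, rfl⟩
  have hD : ∀ j, MeasurableSet ((Set.univ ×ˢ B j) \ O) := fun j =>
    (MeasurableSet.univ.prod (hBo j).measurableSet).diff hO
  -- The natural choice {s | B j ⊆ O_s} need not be measurable. Asking for the inclusion only up to
  -- a null set of the conditional law is a measurable condition on s.
  have hE : ∀ j, MeasurableSet {s | R.condKernel s (Prod.mk s ⁻¹' ((Set.univ ×ˢ B j) \ O)) = 0} :=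
    fun j => Kernel.measurable_kernel_prodMk_left (hD j) (measurableSet_singleton 0)
  refine ⟨_, B, hE, hBo, ?_, ?_⟩
  · rintro ⟨s, a⟩ hsa
    obtain ⟨_, ⟨j, rfl⟩, haj, hjs⟩ := hB.exists_subset_of_mem_open hsa (hsec s)
    refine Set.mem_iUnion.2 ⟨j, ?_, haj⟩
    have : Prod.mk s ⁻¹' ((Set.univ ×ˢ B j) \ O) = ∅ := by
      ext b
      simp only [Set.mem_preimage, Set.mem_sdiff, Set.mem_prod, Set.mem_univ, true_and,
        Set.mem_empty_iff_false, iff_false, not_and, not_not]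
      exact fun hb => hjs hb
    exact (congrArg _ this).trans measure_empty
  · rw [Set.iUnion_sdiff, measure_iUnion_null_iff]
    intro j
    have hm := ((hE j).prod (hBo j).measurableSet).diff hO
    have hdis : ∀ F, (R.fst ⊗ₘ R.condKernel) F = R F := fun F => by rw [R.disintegrate]
    rw [← hdis, Measure.compProd_apply hm, lintegral_eq_zero_iff
      (Kernel.measurable_kernel_prodMk_left hm)]
    refine Eventually.of_forall fun s => ?_
    by_cases hs : R.condKernel s (Prod.mk s ⁻¹' ((Set.univ ×ˢ B j) \ O)) = 0
    · refine measure_mono_null ?_ hs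
      rintro b ⟨⟨_, h1⟩, h2⟩
      exact ⟨⟨trivial, h1⟩, h2⟩
    · have : Prod.mk s ⁻¹' (({s | R.condKernel s (Prod.mk s ⁻¹' ((Set.univ ×ˢ B j) \ O)) = 0} ×ˢ
          B j) \ O) = ∅ := by
        ext b
        simp only [Set.mem_preimage, Set.mem_sdiff, Set.mem_prod, Set.mem_ofPred_eq,
          Set.mem_empty_iff_false, iff_false, not_and, not_not]
        exact fun h => absurd h.1 hs
      exact (congrArg _ this).trans measure_empty

/-- If measures on `S × A` satisfy the portmanteau inequality for open sets and their marginals on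
`S` converge setwise, then the portmanteau inequality holds for all measurable sets with open
sections in `A`. -/
theorem le_liminf_measure_of_isOpen_section {S A : Type*}
    [TopologicalSpace S] [TopologicalSpace.PseudoMetrizableSpace S] [MeasurableSpace S]
    [BorelSpace S]
    [TopologicalSpace A] [SecondCountableTopology A] [MeasurableSpace A] [OpensMeasurableSpace A]
    [StandardBorelSpace A] [Nonempty A] {Q : Measure (S × A)} [IsFiniteMeasure Q]
    {Qs : ℕ → Measure (S × A)} [∀ n, IsFiniteMeasure (Qs n)]
    (hopen : ∀ U, IsOpen U → Q U ≤ liminf (fun n => Qs n U) atTop)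
    (hfst : ∀ D, MeasurableSet D → Tendsto (fun n => (Qs n).fst D) atTop (𝓝 (Q.fst D)))
    {O : Set (S × A)} (hO : MeasurableSet O) (hsec : ∀ s, IsOpen {a | (s, a) ∈ O}) :
    Q O ≤ liminf (fun n => Qs n O) atTop := by
  -- R dominates all `Qs n`, so one union of rectangles serves for every n. For Q only the inclusion
  -- of O in that union is needed.
  obtain ⟨R, hRfin, hR, -⟩ := exists_isFiniteMeasure_absolutelyContinuous (Measure.sum Qs)
  obtain ⟨E, B, hE, hB, hsub, hnull⟩ := exists_ae_eq_iUnion_prod_of_isOpen_section R hO hsec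
  have hQs : ∀ n, Qs n (⋃ j, E j ×ˢ B j) ≤ Qs n O := fun n => by
    have h0 : Qs n ((⋃ j, E j ×ˢ B j) \ O) = 0 :=
      ((Measure.absolutelyContinuous_of_le (Measure.le_sum Qs n)).trans hR) hnull
    calc Qs n (⋃ j, E j ×ˢ B j) ≤ Qs n (O ∪ ((⋃ j, E j ×ˢ B j) \ O)) :=
          measure_mono (by rw [Set.union_sdiff_self]; exact Set.subset_union_right)
      _ ≤ Qs n O + 0 := (measure_union_le _ _).trans (by rw [h0])
      _ = Qs n O := add_zero _
  refine ENNReal.le_of_forall_pos_le_add fun ε hε _ => ?_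
  obtain ⟨ε', hε', hsum⟩ := ENNReal.exists_pos_sum_of_countable' (ENNReal.coe_pos.2 hε).ne' ℕ
  -- Enlarging each `E j` to an open set makes the union of rectangles open. The cost lies over D, a
  -- set of states of small Q-marginal, and by setwise convergence D is eventually small for `Qs n`
  -- as well.
  choose V hEV hV hVlt using fun j =>
    (hE j).exists_isOpen_sdiff_lt (measure_ne_top Q.fst (E j)) (hε' j).ne'
  set D := ⋃ j, V j \ E j with hDdef
  have hD : MeasurableSet D := .iUnion fun j => (hV j).measurableSet.diff (hE j)
  have hDlt : Q.fst D < ε :=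
    (measure_iUnion_le _).trans_lt
      ((ENNReal.tsum_le_tsum fun j => (hVlt j).2.le).trans_lt hsum)
  calc Q O ≤ Q (⋃ j, V j ×ˢ B j) := measure_mono (hsub.trans
          (Set.iUnion_mono fun j => Set.prod_mono (hEV j) subset_rfl))
    _ ≤ liminf (fun n => Qs n (⋃ j, V j ×ˢ B j)) atTop :=
        hopen _ (isOpen_iUnion fun j => (hV j).prod (hB j))
    _ ≤ liminf (fun n => Qs n O + ε) atTop := by
        refine liminf_le_liminf ?_
        filter_upwards [(hfst D hD).eventually_lt_const hDlt] with n hn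
        refine le_trans (b := Qs n ((⋃ j, E j ×ˢ B j) ∪ Prod.fst ⁻¹' D)) (measure_mono ?_)
          ((measure_union_le _ _).trans
            (add_le_add (hQs n) ((Measure.fst_apply hD).ge.trans hn.le)))
        rintro ⟨s, a⟩ hsa
        obtain ⟨j, hs, ha⟩ := Set.mem_iUnion.1 hsa
        by_cases h : s ∈ E j
        · exact Or.inl (Set.mem_iUnion.2 ⟨j, h, ha⟩)
        · exact Or.inr (Set.mem_iUnion.2 ⟨j, hs, h⟩)
    _ = liminf (fun n => Qs n O) atTop + ε := by
        refine liminf_add_const atTop (fun n => Qs n O) ε ?_ ?_ <;> isBoundedDefault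

end MeasureTheory

/-! ### Arithmetic of differences in the extended reals. -/

namespace EReal

theorem coe_sub_add_coe_sub {a b c d : ℝ≥0∞} (ha : a ≠ ⊤) (hc : c ≠ ⊤) :
    ((a : EReal) - b) + (c - d) = ((a + c : ℝ≥0∞) : EReal) - ((b + d : ℝ≥0∞) : EReal) := by
  lift a to NNReal using ha
  lift c to NNReal using hc
  induction b with
  | top => simp
  | coe b =>
    induction d with
    | top => simp
    | coe d =>
      have h : ∀ x : NNReal, ((x : ℝ≥0∞) : EReal) = ((x : ℝ) : EReal) := fun _ => rfl
      rw [← ENNReal.coe_add, ← ENNReal.coe_add]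
      simp only [h]
      norm_cast
      push_cast
      ring

theorem sum_coe_sub {ι : Type*} {a b : ι → ℝ≥0∞} (ha : ∀ n, a n ≠ ⊤) (s : Finset ι) :
    ∑ n ∈ s, ((a n : EReal) - b n) =
      ((∑ n ∈ s, a n : ℝ≥0∞) : EReal) - ((∑ n ∈ s, b n : ℝ≥0∞) : EReal) := by
  classical
  induction s using Finset.induction with
  | empty => simp
  | insert n s hn ih =>
    rw [Finset.sum_insert hn, Finset.sum_insert hn, Finset.sum_insert hn, ih,
      coe_sub_add_coe_sub (ha n) (ENNReal.sum_ne_top.2 fun k _ => ha k)]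

/-- Summation of differences of nonnegative terms whose positive parts have a finite sum. -/
theorem tsum_coe_sub {ι : Type*} {a b : ι → ℝ≥0∞} (ha : ∑' n, a n ≠ ⊤) :
    ∑' n, ((a n : EReal) - b n) =
      ((∑' n, a n : ℝ≥0∞) : EReal) - ((∑' n, b n : ℝ≥0∞) : EReal) := by
  refine HasSum.tsum_eq ?_
  have h1 : Tendsto (fun s : Finset ι => ((∑ n ∈ s, a n : ℝ≥0∞) : EReal)) atTop
      (𝓝 ((∑' n, a n : ℝ≥0∞) : EReal)) :=
    (continuous_coe_ennreal_ereal.tendsto _).comp ENNReal.summable.hasSum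
  have h2 : Tendsto (fun s : Finset ι => -((∑ n ∈ s, b n : ℝ≥0∞) : EReal)) atTop
      (𝓝 (-((∑' n, b n : ℝ≥0∞) : EReal))) :=
    (continuous_neg.tendsto _).comp
      ((continuous_coe_ennreal_ereal.tendsto _).comp ENNReal.summable.hasSum)
  have h3 := (EReal.continuousAt_add (p := (((∑' n, a n : ℝ≥0∞) : EReal),
    -((∑' n, b n : ℝ≥0∞) : EReal))) (Or.inl (by simpa using ha))
    (Or.inl (EReal.coe_ennreal_ne_bot _))).tendsto.comp (h1.prodMk_nhds h2)
  refine h3.congr fun s => ?_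
  rw [sum_coe_sub fun n => ENNReal.ne_top_of_tsum_ne_top ha n]
  rfl

theorem coe_mul_eq_coe_sub {b : ℝ} (hb : 0 < b) {x : EReal} (hx : x ≠ ⊤) :
    (b : EReal) * x = ((ENNReal.ofReal b * x.toENNReal : ℝ≥0∞) : EReal) -
      ((ENNReal.ofReal b * (-x).toENNReal : ℝ≥0∞) : EReal) := by
  induction x with
  | top => exact absurd rfl hx
  | bot =>
    have : ENNReal.ofReal b ≠ 0 := by simpa using hb
    simp [EReal.coe_mul_bot_of_pos hb, ENNReal.mul_top this]
  | coe x =>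
    rw [← EReal.coe_neg, EReal.real_coe_toENNReal, EReal.real_coe_toENNReal,
      ← ENNReal.ofReal_mul hb.le, ← ENNReal.ofReal_mul hb.le, EReal.coe_ennreal_ofReal,
      EReal.coe_ennreal_ofReal]
    norm_cast
    rcases le_total 0 x with h | h
    · rw [max_eq_left (by positivity), max_eq_right (by nlinarith), sub_zero]
    · rw [max_eq_right (by nlinarith), max_eq_left (by nlinarith)]; ring

theorem toENNReal_coe_sub (a b : ℝ≥0∞) :
    ((a : EReal) - b).toENNReal = a - b := by
  rw [EReal.toENNReal_sub (EReal.coe_ennreal_nonneg b), EReal.toENNReal_coe, EReal.toENNReal_coe]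

theorem toENNReal_neg_coe_sub (a b : ℝ≥0∞) (ha : a ≠ ⊤) :
    (-((a : EReal) - b)).toENNReal = b - a := by
  rw [EReal.neg_sub (Or.inl (EReal.coe_ennreal_ne_bot _)) (Or.inl (by simpa using ha)),
    add_comm, ← sub_eq_add_neg, EReal.toENNReal_sub (EReal.coe_ennreal_nonneg a),
    EReal.toENNReal_coe, EReal.toENNReal_coe]

/-- The splitting x⁺ - x⁻ = l + (x - l)⁺ - (l - x)⁺ with all negative terms moved across, so that it
survives x = -∞ and can be integrated in `ℝ≥0∞`. -/
theorem toENNReal_natCast_sub_add {x : EReal} (hx : x ≠ ⊤) (l : ℕ) :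
    x.toENNReal + ((l : EReal) - x).toENNReal =
      (-x).toENNReal + (l + (x - l).toENNReal) := by
  induction x with
  | top => exact absurd rfl hx
  | bot =>
    have : (l : EReal) - ⊥ = ⊤ := EReal.sub_bot (by exact_mod_cast EReal.natCast_ne_bot l)
    simp [this]
  | coe x =>
    have hl : (l : EReal) = ((l : ℝ) : EReal) := rfl
    have h0 : (0 : ℝ) ≤ l := l.cast_nonneg
    rw [hl, ← EReal.coe_sub, ← EReal.coe_sub, ← EReal.coe_neg]
    simp only [EReal.real_coe_toENNReal]
    rw [← ENNReal.ofReal_natCast l]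
    rcases le_total 0 x with h | h <;> rcases le_total x l with h' | h'
    · rw [ENNReal.ofReal_of_nonpos (p := -x) (by linarith),
        ENNReal.ofReal_of_nonpos (p := x - l) (by linarith), zero_add, add_zero,
        ← ENNReal.ofReal_add h (by linarith)]
      congr 1; ring
    · rw [ENNReal.ofReal_of_nonpos (p := -x) (by linarith),
        ENNReal.ofReal_of_nonpos (p := l - x) (by linarith), zero_add, add_zero,
        ← ENNReal.ofReal_add h0 (by linarith)]
      congr 1; ring
    · rw [ENNReal.ofReal_of_nonpos (p := x) h,
        ENNReal.ofReal_of_nonpos (p := x - l) (by linarith), zero_add, add_zero,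
        ← ENNReal.ofReal_add (by linarith) h0]
      congr 1; ring
    · obtain rfl : x = 0 := le_antisymm h (h0.trans h')
      obtain h0' : (l : ℝ) = 0 := le_antisymm h' h0
      simp [h0']

theorem toENNReal_sub_natCast_le_indicator {S : Type*} {w : S → ℝ} {x : EReal} {s : S}
    (hx : x ≤ w s) (l : ℕ) :
    (x - l).toENNReal ≤ {s | (l : ℝ) ≤ w s}.indicator (fun s => ENNReal.ofReal (w s)) s := by
  have hl : (l : EReal) = ((l : ℝ) : EReal) := rfl
  have h1 : x - l ≤ ((w s - l : ℝ) : EReal) := by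
    rw [EReal.coe_sub, hl]; exact EReal.sub_le_sub hx le_rfl
  refine (EReal.toENNReal_le_toENNReal h1).trans ?_
  rw [EReal.real_coe_toENNReal]
  by_cases h : (l : ℝ) ≤ w s
  · rw [Set.indicator_of_mem (by exact h)]
    exact ENNReal.ofReal_le_ofReal (by simp)
  · rw [ENNReal.ofReal_of_nonpos (by linarith [not_le.1 h])]
    exact zero_le

/-- Since pos - neg = L + d - g, a lower bound on the reward and a small excess d bound the
shortfall g from above. The sign of L - c' is recorded because `ENNReal.ofReal` truncates at zero.
-/
theorem le_ofReal_of_le_coe_sub {pos neg g L d : ℝ≥0∞} {c c' : ℝ} (hpos : pos ≠ ⊤) (hL : L ≠ ⊤)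
    (h : pos + g = neg + (L + d)) (hd : d ≤ ENNReal.ofReal (c - c')) (hc' : c' ≤ c)
    (hc : (c : EReal) ≤ (pos : EReal) - neg) :
    0 ≤ L.toReal - c' ∧ g ≤ ENNReal.ofReal (L.toReal - c') := by
  have hdtop : d ≠ ⊤ := (hd.trans_lt ENNReal.ofReal_lt_top).ne
  have hneg : neg ≠ ⊤ := by
    rintro rfl
    simp at hc
  have hg : g ≠ ⊤ := by
    rintro rfl
    exact (ENNReal.add_lt_top.2 ⟨hneg.lt_top, ENNReal.add_lt_top.2
      ⟨hL.lt_top, hdtop.lt_top⟩⟩).ne (by rw [← h, add_top])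
  have hd' : d.toReal ≤ c - c' := ENNReal.toReal_le_of_le_ofReal (by linarith) hd
  have h' := congrArg ENNReal.toReal h
  rw [ENNReal.toReal_add hpos hg, ENNReal.toReal_add hneg (by simp [hL, hdtop]),
    ENNReal.toReal_add hL hdtop] at h'
  have hc2 : c ≤ pos.toReal - neg.toReal := by
    rw [← EReal.coe_ennreal_toReal hpos, ← EReal.coe_ennreal_toReal hneg] at hc
    exact_mod_cast hc
  have hg0 : 0 ≤ g.toReal := ENNReal.toReal_nonneg
  have hle : g.toReal ≤ L.toReal - c' := by linarith
  exact ⟨hg0.trans hle, (ENNReal.le_ofReal_iff_toReal_le hg (hg0.trans hle)).2 hle⟩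

/-- The way back from the shortfall to the reward: here the excess d is simply dropped, being
nonnegative. -/
theorem coe_le_coe_sub_of_le_ofReal {pos neg g L d : ℝ≥0∞} {c : ℝ} (hpos : pos ≠ ⊤)
    (hL : L ≠ ⊤) (h : pos + g = neg + (L + d)) (hc : 0 ≤ L.toReal - c)
    (hg : g ≤ ENNReal.ofReal (L.toReal - c)) :
    (c : EReal) ≤ (pos : EReal) - neg := by
  have hgtop : g ≠ ⊤ := (hg.trans_lt ENNReal.ofReal_lt_top).ne
  have hsum : neg + (L + d) ≠ ⊤ := by rw [← h]; simp [hpos, hgtop]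
  obtain ⟨hneg, hLd⟩ := ENNReal.add_ne_top.1 hsum
  obtain ⟨-, hdtop⟩ := ENNReal.add_ne_top.1 hLd
  have h' := congrArg ENNReal.toReal h
  rw [ENNReal.toReal_add hpos hgtop, ENNReal.toReal_add hneg hLd,
    ENNReal.toReal_add hL hdtop] at h'
  have hg' := ENNReal.toReal_le_of_le_ofReal hc hg
  have hd0 : 0 ≤ d.toReal := ENNReal.toReal_nonneg
  rw [← EReal.coe_ennreal_toReal hpos, ← EReal.coe_ennreal_toReal hneg]
  have : c ≤ pos.toReal - neg.toReal := by linarith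
  exact_mod_cast this

end EReal

/-! ### Splitting the reward at a level, and uniform smallness of the excess. -/

namespace CMDP

section Measurable

variable {S : Type u} {A : Type v} [MeasurableSpace S] [MeasurableSpace A] {m : ℕ}

theorem measurable_reward (M : CMDP S A m) (i : Fin (m + 1)) : Measurable (M.reward i) := by
  classical
  refine Measurable.dite (f := M.r i) (g := fun _ => 0) (M.measurable_r i) measurable_const
    M.measurableSet_graph

theorem reward_ne_top (M : CMDP S A m) (i : Fin (m + 1)) (x : S × A) : M.reward i x ≠ ⊤ := by
  unfold reward
  split_ifs with h
  · exact M.r_ne_top i _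
  · simp

theorem IsUpperBound.reward_le {M : CMDP S A m} {w : S → ℝ} (h : M.IsUpperBound w)
    (i : Fin (m + 1)) (x : S × A) : M.reward i x ≤ w x.1 := by
  unfold reward
  split_ifs with hx
  · exact h.r_le i ⟨x, hx⟩
  · exact_mod_cast zero_le_one.trans (h.one_le x.1)

theorem discount_le_one (M : CMDP S A m) (n : ℕ) : ENNReal.ofReal (M.β ^ n) ≤ 1 := by
  simpa using pow_le_one₀ M.β_pos.le M.β_lt_one.le

theorem tsum_discount_ne_top (M : CMDP S A m) :
    ∑' n : ℕ, ENNReal.ofReal (M.β ^ n) ≠ ⊤ :=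
  (summable_geometric_of_lt_one M.β_pos.le M.β_lt_one).tsum_ofReal_ne_top

/-- The expected total discounted negative part of the reward. -/
noncomputable def Jneg (M : CMDP S A m) (i : Fin (m + 1)) (P : ProbabilityMeasure (ℕ → S × A)) :
    ℝ≥0∞ :=
  ∫⁻ ω, ∑' n : ℕ, ENNReal.ofReal (M.β ^ n) * (-M.reward i (ω n)).toENNReal
    ∂(P : Measure (ℕ → S × A))

/-- The expected total discounted amount by which the reward stays below the level `l`. -/
noncomputable def shortfall (M : CMDP S A m) (i : Fin (m + 1)) (l : ℕ)
    (P : ProbabilityMeasure (ℕ → S × A)) : ℝ≥0∞ :=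
  ∫⁻ ω, ∑' n : ℕ, ENNReal.ofReal (M.β ^ n) * ((l : EReal) - M.reward i (ω n)).toENNReal
    ∂(P : Measure (ℕ → S × A))

/-- The expected total discounted amount by which the reward exceeds the level `l`. -/
noncomputable def excess (M : CMDP S A m) (i : Fin (m + 1)) (l : ℕ)
    (P : ProbabilityMeasure (ℕ → S × A)) : ℝ≥0∞ :=
  ∫⁻ ω, ∑' n : ℕ, ENNReal.ofReal (M.β ^ n) * (M.reward i (ω n) - l).toENNReal
    ∂(P : Measure (ℕ → S × A))

theorem measurable_discounted (M : CMDP S A m) {f : S × A → ℝ≥0∞} (hf : Measurable f) :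
    Measurable fun ω : ℕ → S × A => ∑' n : ℕ, ENNReal.ofReal (M.β ^ n) * f (ω n) :=
  Measurable.tsum fun n => (hf.comp (measurable_pi_apply n)).const_mul _

/-- `J` integrates the positive and negative parts of the whole discounted sum p - q, whereas `Jpos`
and `Jneg` integrate p and q themselves. The two differences agree by integrating p + (q - p)⁺ = q +
(p - q)⁺. -/
theorem J_eq_Jpos_sub_Jneg (M : CMDP S A m) (i : Fin (m + 1))
    (P : ProbabilityMeasure (ℕ → S × A)) (hP : M.Jpos i P ≠ ⊤) :
    M.J i P = (M.Jpos i P : EReal) - M.Jneg i P := by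
  set p : (ℕ → S × A) → ℝ≥0∞ := fun ω =>
    ∑' n : ℕ, ENNReal.ofReal (M.β ^ n) * (M.reward i (ω n)).toENNReal with hp
  set q : (ℕ → S × A) → ℝ≥0∞ := fun ω =>
    ∑' n : ℕ, ENNReal.ofReal (M.β ^ n) * (-M.reward i (ω n)).toENNReal with hq
  have hpm : Measurable p := M.measurable_discounted (M.measurable_reward i).ereal_toENNReal
  have hqm : Measurable q := M.measurable_discounted (M.measurable_reward i).neg.ereal_toENNReal
  have hfin : ∀ᵐ ω ∂(P : Measure (ℕ → S × A)), p ω ≠ ⊤ :=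
    (ae_lt_top hpm hP).mono fun ω h => h.ne
  have hsum : ∀ᵐ ω ∂(P : Measure (ℕ → S × A)),
      ∑' n : ℕ, ((M.β ^ n : ℝ) : EReal) * M.reward i (ω n) = (p ω : EReal) - q ω := by
    filter_upwards [hfin] with ω hω
    rw [← EReal.tsum_coe_sub hω]
    exact tsum_congr fun n =>
      EReal.coe_mul_eq_coe_sub (pow_pos M.β_pos n) (M.reward_ne_top i _)
  have h1 : ∫⁻ ω, (∑' n : ℕ, ((M.β ^ n : ℝ) : EReal) * M.reward i (ω n)).toENNReal
      ∂(P : Measure (ℕ → S × A)) = ∫⁻ ω, (p ω - q ω) ∂(P : Measure (ℕ → S × A)) := by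
    refine lintegral_congr_ae ?_
    filter_upwards [hsum] with ω h
    rw [h, EReal.toENNReal_coe_sub]
  have h2 : ∫⁻ ω, (-∑' n : ℕ, ((M.β ^ n : ℝ) : EReal) * M.reward i (ω n)).toENNReal
      ∂(P : Measure (ℕ → S × A)) = ∫⁻ ω, (q ω - p ω) ∂(P : Measure (ℕ → S × A)) := by
    refine lintegral_congr_ae ?_
    filter_upwards [hsum, hfin] with ω h h'
    rw [h, EReal.toENNReal_neg_coe_sub _ _ h']
  have h3 : M.Jpos i P + ∫⁻ ω, (q ω - p ω) ∂(P : Measure (ℕ → S × A)) =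
      M.Jneg i P + ∫⁻ ω, (p ω - q ω) ∂(P : Measure (ℕ → S × A)) := by
    unfold Jpos Jneg
    rw [← lintegral_add_left hpm, ← lintegral_add_left hqm]
    exact lintegral_congr fun ω => by rw [add_tsub_eq_max, add_tsub_eq_max, max_comm]
  have h4 : ∫⁻ ω, (p ω - q ω) ∂(P : Measure (ℕ → S × A)) ≠ ⊤ :=
    ((lintegral_mono fun ω => tsub_le_self).trans_lt hP.lt_top).ne
  have h5 := EReal.coe_sub_add_coe_sub (b := M.Jneg i P)
    (d := ∫⁻ ω, (p ω - q ω) ∂(P : Measure (ℕ → S × A))) hP h4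
  unfold J expect
  rw [h1, h2]
  generalize ∫⁻ ω, (p ω - q ω) ∂(P : Measure (ℕ → S × A)) = x at *
  generalize ∫⁻ ω, (q ω - p ω) ∂(P : Measure (ℕ → S × A)) = y at *
  -- If y is infinite, so is `Jneg`, and both sides equal -∞.
  by_cases hy : y = ⊤
  · have : M.Jneg i P = ⊤ := by
      subst hy
      rw [add_top] at h3
      exact (ENNReal.add_eq_top.1 h3.symm).resolve_right h4
    rw [this, hy]
    simp
  · have hn : M.Jneg i P ≠ ⊤ := by
      intro hn
      rw [hn, top_add] at h3
      exact (ENNReal.add_ne_top.2 ⟨hP, hy⟩) h3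
    have h6 := congrArg ENNReal.toReal h3
    rw [ENNReal.toReal_add hP hy, ENNReal.toReal_add hn h4] at h6
    rw [← EReal.coe_ennreal_toReal h4, ← EReal.coe_ennreal_toReal hy,
      ← EReal.coe_ennreal_toReal hP, ← EReal.coe_ennreal_toReal hn]
    norm_cast
    linarith

theorem Jpos_add_shortfall (M : CMDP S A m) (i : Fin (m + 1)) (l : ℕ)
    (P : ProbabilityMeasure (ℕ → S × A)) :
    M.Jpos i P + M.shortfall i l P =
      M.Jneg i P + ((∑' n : ℕ, ENNReal.ofReal (M.β ^ n)) * l + M.excess i l P) := by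
  have hr := M.measurable_reward i
  have hL : (∑' n : ℕ, ENNReal.ofReal (M.β ^ n)) * l =
      ∫⁻ _, ∑' n : ℕ, ENNReal.ofReal (M.β ^ n) * (l : ℝ≥0∞) ∂(P : Measure (ℕ → S × A)) := by
    simp [ENNReal.tsum_mul_right]
  unfold Jpos shortfall Jneg excess
  rw [hL, ← lintegral_add_left (M.measurable_discounted hr.ereal_toENNReal),
    ← lintegral_add_left measurable_const,
    ← lintegral_add_left
      (M.measurable_discounted (f := fun x => (-M.reward i x).toENNReal) hr.neg.ereal_toENNReal)]
  refine lintegral_congr fun ω => ?_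
  simp only [← ENNReal.tsum_add]
  refine tsum_congr fun n => ?_
  rw [← mul_add, ← mul_add, ← mul_add,
    EReal.toENNReal_natCast_sub_add (M.reward_ne_top i _)]

theorem UniformlyIntegrable.exists_excess_le {M : CMDP S A m} {w : S → ℝ}
    (hA1 : M.IsUpperBound w) (hA2 : M.UniformlyIntegrable w) (i : Fin (m + 1))
    {ε : ℝ≥0∞} (hε : ε ≠ 0) :
    ∃ l : ℕ, ∀ P ∈ M.strategicMeasures, M.excess i l P ≤ ε := by
  have hε2 : 0 < ε / 2 := ENNReal.half_pos hε
  -- The tail condition disposes of all times from N on, whatever the level. Only N times remain, so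
  -- a single `l` works for all of them.
  obtain ⟨N, hN⟩ := (hA2.tail.eventually_lt_const hε2).exists
  obtain ⟨δ, hδ, hsum⟩ := ENNReal.exists_pos_sum_of_countable' hε2.ne' ℕ
  obtain ⟨l, hl⟩ := ((Finset.eventually_all (Finset.range N)).2 fun n _ =>
    (hA2.unifInt n).eventually_lt_const (hδ n)).exists
  refine ⟨l, fun P hP => ?_⟩
  set e : S × A → ℝ≥0∞ := fun x =>
    {s : S | (l : ℝ) ≤ w s}.indicator (fun s => ENNReal.ofReal (w s)) x.1 with he
  have hem : Measurable e :=
    (Measurable.indicator (by have := hA1.measurable; fun_prop)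
      (measurableSet_le measurable_const hA1.measurable)).comp measurable_fst
  calc M.excess i l P
      ≤ ∫⁻ ω, ((∑ n ∈ Finset.range N, e (ω n)) +
          ∑' k : ℕ, ENNReal.ofReal (M.β ^ (N + k) * w (ω (N + k)).1))
          ∂(P : Measure (ℕ → S × A)) := by
        refine lintegral_mono fun ω => ?_
        rw [← (ENNReal.summable).sum_add_tsum_nat_add' (k := N)]
        have hle : ∀ n, (M.reward i (ω n) - l).toENNReal ≤ e (ω n) := fun n =>
          EReal.toENNReal_sub_natCast_le_indicator (hA1.reward_le i (ω n)) l
        refine add_le_add (Finset.sum_le_sum fun n _ => ?_) (ENNReal.tsum_le_tsum fun k => ?_)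
        · exact (mul_le_mul' (M.discount_le_one n) (hle n)).trans (one_mul _).le
        · rw [add_comm k N, ENNReal.ofReal_mul (pow_nonneg M.β_pos.le _)]
          gcongr
          exact (hle _).trans (Set.indicator_le_self _ _ _)
    _ = ∑ n ∈ Finset.range N, ∫⁻ ω, e (ω n) ∂(P : Measure (ℕ → S × A)) +
          ∫⁻ ω, ∑' k : ℕ, ENNReal.ofReal (M.β ^ (N + k) * w (ω (N + k)).1)
            ∂(P : Measure (ℕ → S × A)) := by
        have hen : ∀ n, Measurable fun ω : ℕ → S × A => e (ω n) := fun n =>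
          hem.comp (measurable_pi_apply n)
        rw [lintegral_add_left (Finset.measurable_fun_sum _ fun n _ => hen n),
          lintegral_finsetSum _ fun n _ => hen n]
    _ ≤ ∑ n ∈ Finset.range N, δ n + ε / 2 := by
        refine add_le_add (Finset.sum_le_sum fun n hn => ?_) ?_
        · exact (le_iSup₂ (f := fun (P : ProbabilityMeasure (ℕ → S × A))
            (_ : P ∈ M.strategicMeasures) => ∫⁻ ω, e (ω n) ∂(P : Measure (ℕ → S × A)))
            P hP).trans (hl n hn).le
        · exact (le_iSup₂ (f := fun (P : ProbabilityMeasure (ℕ → S × A))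
            (_ : P ∈ M.strategicMeasures) => ∫⁻ ω, ∑' k : ℕ,
              ENNReal.ofReal (M.β ^ (N + k) * w (ω (N + k)).1) ∂(P : Measure (ℕ → S × A)))
            P hP).trans hN.le
    _ ≤ ε / 2 + ε / 2 := by
        gcongr
        exact (ENNReal.sum_le_tsum _).trans hsum.le
    _ = ε := ENNReal.add_halves ε

theorem Jpos_lt_top {M : CMDP S A m} {w : S → ℝ} (hA1 : M.IsUpperBound w)
    (hA2 : M.UniformlyIntegrable w) (i : Fin (m + 1)) {P : ProbabilityMeasure (ℕ → S × A)}
    (hP : P ∈ M.strategicMeasures) : M.Jpos i P < ⊤ := by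
  -- Any fixed bound on the excess will do, since r⁺ ≤ l + (r - l)⁺.
  obtain ⟨l, hl⟩ := hA2.exists_excess_le hA1 i one_ne_zero
  refine lt_of_le_of_lt (b := (∑' n : ℕ, ENNReal.ofReal (M.β ^ n)) * l + M.excess i l P) ?_
    (ENNReal.add_lt_top.2 ⟨ENNReal.mul_lt_top M.tsum_discount_ne_top.lt_top (by simp),
      (hl P hP).trans_lt ENNReal.one_lt_top⟩)
  have hL : (∑' n : ℕ, ENNReal.ofReal (M.β ^ n)) * l =
      ∫⁻ _, ∑' n : ℕ, ENNReal.ofReal (M.β ^ n) * (l : ℝ≥0∞) ∂(P : Measure (ℕ → S × A)) := by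
    simp [ENNReal.tsum_mul_right]
  unfold Jpos excess
  rw [hL, ← lintegral_add_left measurable_const]
  refine lintegral_mono fun ω => ?_
  rw [← ENNReal.tsum_add]
  refine ENNReal.tsum_le_tsum fun n => ?_
  rw [← mul_add]
  gcongr
  have h := EReal.toENNReal_add_le (x := (l : EReal)) (y := M.reward i (ω n) - l)
  have h1 : (l : EReal) + (M.reward i (ω n) - l) = M.reward i (ω n) := by
    rw [add_comm]
    exact EReal.sub_add_cancel (b := (l : ℝ))
  have h2 : (l : EReal).toENNReal = l := by
    rw [show (l : EReal) = ((l : ℝ) : EReal) from rfl, EReal.real_coe_toENNReal,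
      ENNReal.ofReal_natCast]
  rwa [h1, h2] at h

end Measurable

end CMDP

/-! ### Borel spaces are metrizable and standard Borel. -/

theorem BorelSubspaceOfPolish.metrizableSpace (Y : Type u) [TopologicalSpace Y]
    [MeasurableSpace Y] [h : BorelSubspaceOfPolish Y] : TopologicalSpace.MetrizableSpace Y := by
  obtain ⟨Z, _, _, f, hf, _⟩ := h.exists_embedding
  exact hf.metrizableSpace

/-- A finer Polish topology with the same Borel sets makes the range closed; its pullback is then
Polish and generates the given sigma-algebra. -/
theorem MeasurableEmbedding.standardBorelSpace {Y Z : Type*} [MeasurableSpace Y]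
    [MeasurableSpace Z] [StandardBorelSpace Z] {f : Y → Z} (hf : MeasurableEmbedding f) :
    StandardBorelSpace Y := by
  obtain ⟨t, _, _, hclosed, -⟩ := hf.measurableSet_range.isClopenable'
  let : TopologicalSpace Y := t.induced f
  have hce : IsClosedEmbedding f := ⟨⟨⟨rfl⟩, hf.injective⟩, hclosed⟩
  refine ⟨t.induced f, ⟨?_⟩, hce.polishSpace⟩
  rw [borel_comap, ← BorelSpace.measurable_eq, hf.comap_eq]

theorem BorelSubspaceOfPolish.standardBorelSpace (Y : Type u) [TopologicalSpace Y]
    [MeasurableSpace Y] [h : BorelSubspaceOfPolish Y] : StandardBorelSpace Y := by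
  obtain ⟨Z, _, _, f, hf, hr⟩ := h.exists_embedding
  borelize Z
  exact (hf.measurableEmbedding hr).standardBorelSpace

/-! ### Laws of the state-action pairs under strategic measures. -/

namespace CMDP

section Measurable

variable {S : Type u} {A : Type v} [MeasurableSpace S] [MeasurableSpace A] {m : ℕ}

theorem IsTrajectoryLaw.map_state_succ {M : CMDP S A m} {π : M.Policy} {Q : Measure (ℕ → M.K)}
    [IsFiniteMeasure Q] (h : M.IsTrajectoryLaw π Q) (n : ℕ) {D : Set S} (hD : MeasurableSet D) :
    Q {ω | (ω (n + 1)).1.1 ∈ D} = ∫⁻ ω, M.p (ω n) D ∂Q := by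
  have := M.isMarkovKernel_p
  have hpast : Measurable (M.past (n + 1)) :=
    measurable_pi_lambda _ fun i => measurable_pi_apply _
  have hst : Measurable fun ω : ℕ → M.K => (ω (n + 1)).1.1 := by fun_prop
  have h1 := congrArg (fun μ => μ (Prod.snd ⁻¹' D)) (h.transition n)
  rw [Measure.map_apply (hpast.prodMk hst) (measurable_snd hD),
    Measure.compProd_apply (measurable_snd hD), lintegral_map
      (Kernel.measurable_kernel_prodMk_left (measurable_snd hD)) hpast] at h1
  exact h1

open Classical in
/-- Extension of a function on feasible pairs to all pairs, with the value `∞` at infeasible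
pairs. -/
noncomputable def extendTop (M : CMDP S A m) (f : M.K → ℝ≥0∞) (x : S × A) : ℝ≥0∞ :=
  if h : x.2 ∈ M.act x.1 then f ⟨x, h⟩ else ⊤

theorem measurable_extendTop (M : CMDP S A m) {f : M.K → ℝ≥0∞} (hf : Measurable f) :
    Measurable (M.extendTop f) := by
  classical
  exact Measurable.dite (f := f) (g := fun _ => ⊤) hf measurable_const M.measurableSet_graph

theorem extendTop_coe (M : CMDP S A m) (f : M.K → ℝ≥0∞) (k : M.K) :
    M.extendTop f k.1 = f k := dif_pos k.2

/-- The value ∞ keeps sublevel sets inside the graph, so a sublevel set closed in the graph is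
closed in the product when the graph is. The same applies to sections. -/
theorem compl_setOf_lt_extendTop (M : CMDP S A m) (f : M.K → ℝ≥0∞) {t : ℝ≥0∞}
    (ht : t ≠ ⊤) :
    {x | t < M.extendTop f x}ᶜ = Subtype.val '' {k | f k ≤ t} := by
  ext x
  simp only [Set.mem_compl_iff, Set.mem_ofPred_eq, not_lt, Set.mem_image]
  constructor
  · intro h
    by_cases hx : x.2 ∈ M.act x.1
    · exact ⟨⟨x, hx⟩, by rwa [← M.extendTop_coe f ⟨x, hx⟩], rfl⟩
    · rw [extendTop, dif_neg hx, top_le_iff] at h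
      exact absurd h ht
  · rintro ⟨k, hk, rfl⟩
    rwa [M.extendTop_coe]

/-- The law of the state-action pair at time `n`. -/
noncomputable def pairLaw (n : ℕ) (P : ProbabilityMeasure (ℕ → S × A)) : Measure (S × A) :=
  (P : Measure (ℕ → S × A)).map fun ω => ω n

instance (n : ℕ) (P : ProbabilityMeasure (ℕ → S × A)) : IsProbabilityMeasure (pairLaw n P) :=
  Measure.isProbabilityMeasure_map (measurable_pi_apply n).aemeasurable

theorem ae_feasible {M : CMDP S A m} {P : ProbabilityMeasure (ℕ → S × A)}
    (hP : P ∈ M.strategicMeasures) (n : ℕ) :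
    ∀ᵐ x ∂(pairLaw n P), x.2 ∈ M.act x.1 := by
  obtain ⟨π, Q, -, hPQ⟩ := hP
  have hm : Measurable fun (ω : ℕ → M.K) (n : ℕ) => (ω n).1 := by fun_prop
  rw [pairLaw, hPQ, Measure.map_map (by fun_prop) hm,
    ae_map_iff ((measurable_pi_apply n).comp hm).aemeasurable M.measurableSet_graph]
  exact Eventually.of_forall fun ω => (ω n).2

theorem pairLaw_zero_fst {M : CMDP S A m} {P : ProbabilityMeasure (ℕ → S × A)}
    (hP : P ∈ M.strategicMeasures) : (pairLaw 0 P).fst = M.μ := by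
  obtain ⟨π, Q, hQ, hPQ⟩ := hP
  have hm : Measurable fun (ω : ℕ → M.K) (n : ℕ) => (ω n).1 := by fun_prop
  rw [Measure.fst, pairLaw, hPQ, Measure.map_map (by fun_prop) hm,
    Measure.map_map (by fun_prop) (by fun_prop), ← hQ.initial]
  rfl

theorem pairLaw_succ_fst {M : CMDP S A m} {P : ProbabilityMeasure (ℕ → S × A)}
    (hP : P ∈ M.strategicMeasures) (n : ℕ) {D : Set S} (hD : MeasurableSet D) :
    (pairLaw (n + 1) P).fst D = ∫⁻ x, M.extendTop (fun k => M.p k D) x ∂(pairLaw n P) := by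
  obtain ⟨π, Q, hQ, hPQ⟩ := hP
  have hm : Measurable fun (ω : ℕ → M.K) (n : ℕ) => (ω n).1 := by fun_prop
  have hQfin : IsFiniteMeasure Q := by
    have h1 := congrArg (fun μ => μ Set.univ) hPQ
    simp only [Measure.map_apply hm MeasurableSet.univ, Set.preimage_univ, measure_univ] at h1
    exact ⟨by rw [← h1]; exact ENNReal.one_lt_top⟩
  rw [Measure.fst, pairLaw, pairLaw, hPQ, Measure.map_map (by fun_prop) hm,
    Measure.map_map (by fun_prop) hm,
    Measure.map_map (by fun_prop) (by fun_prop), Measure.map_apply (by fun_prop) hD,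
    lintegral_map (M.measurable_extendTop (M.p.measurable_coe hD)) (by fun_prop)]
  refine (hQ.map_state_succ n hD).trans (lintegral_congr fun ω => ?_)
  exact (M.extendTop_coe (fun k => M.p k D) (ω n)).symm

theorem shortfall_eq_tsum (M : CMDP S A m) (i : Fin (m + 1)) (l : ℕ)
    (P : ProbabilityMeasure (ℕ → S × A)) :
    M.shortfall i l P = ∑' n : ℕ, ENNReal.ofReal (M.β ^ n) *
      ∫⁻ x, ((l : EReal) - M.reward i x).toENNReal ∂(pairLaw n P) := by
  have hf : Measurable fun x => ((l : EReal) - M.reward i x).toENNReal :=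
    (measurable_const.sub (M.measurable_reward i)).ereal_toENNReal
  have hfn : ∀ n, Measurable fun ω : ℕ → S × A => ((l : EReal) - M.reward i (ω n)).toENNReal :=
    fun n => hf.comp (measurable_pi_apply n)
  rw [shortfall, lintegral_tsum fun n => ((hfn n).const_mul _).aemeasurable]
  refine tsum_congr fun n => ?_
  rw [lintegral_const_mul _ (hfn n), pairLaw, lintegral_map hf (measurable_pi_apply n)]

end Measurable

end CMDP

/-! ### Lower semicontinuity of the shortfall. -/

namespace ENNReal

/-- Fatou's lemma for counting measure. -/
theorem tsum_mul_liminf_le {ι : Type*} (c : ι → ℝ≥0∞) (a : ι → ℕ → ℝ≥0∞) :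
    ∑' n, c n * liminf (a n) atTop ≤ liminf (fun k => ∑' n, c n * a n k) atTop := by
  let : MeasurableSpace ι := ⊤
  simp_rw [← lintegral_count]
  refine le_trans (lintegral_mono fun n => ?_)
    (lintegral_liminf_le fun k => measurable_from_top)
  have h := ENNReal.le_liminf_mul (u := fun _ : ℕ => c n) (v := a n) (f := atTop)
  rw [liminf_const] at h
  exact h

end ENNReal

namespace CMDP

section Topological

variable {S : Type u} {A : Type v} [MeasurableSpace S] [MeasurableSpace A] [TopologicalSpace A]
  {m : ℕ}

theorem isOpen_section_lt_extendTop [T2Space A] {M : CMDP S A m} {s : S} (hs : IsCompact (M.act s))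
    {f : M.K → ℝ≥0∞} (hf : LowerSemicontinuous fun a : M.act s => f ⟨(s, a.1), a.2⟩)
    (t : ℝ≥0∞) : IsOpen {a | t < M.extendTop f (s, a)} := by
  rcases eq_or_ne t ⊤ with rfl | ht
  · simp
  have h : {a | t < M.extendTop f (s, a)}ᶜ =
      Subtype.val '' ((fun a : M.act s => f ⟨(s, a.1), a.2⟩) ⁻¹' Set.Iic t) := by
    change Prod.mk s ⁻¹' {x | t < M.extendTop f x}ᶜ = _
    rw [M.compl_setOf_lt_extendTop f ht]
    ext a
    constructor
    · rintro ⟨⟨⟨s', a'⟩, hk⟩, hkt, h⟩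
      obtain ⟨rfl, rfl⟩ := Prod.mk.inj h
      exact ⟨⟨a', hk⟩, hkt, rfl⟩
    · rintro ⟨⟨a', ha'⟩, hat, rfl⟩
      exact ⟨⟨(s, a'), ha'⟩, hat, rfl⟩
  rw [← isClosed_compl_iff, h]
  exact hs.isClosed.isClosedEmbedding_subtypeVal.isClosedMap _ (hf.isClosed_preimage t)

variable [TopologicalSpace S]

/-- If a is not in A(s), regularity gives a closed neighbourhood B of a disjoint from the compact
set A(s). The states whose action sets miss B form an open set containing s. -/
theorem IsWeaklyContinuous.isClosed_graph [T3Space A] {M : CMDP S A m} (h : M.IsWeaklyContinuous) :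
    IsClosed {x : S × A | x.2 ∈ M.act x.1} := by
  rw [← isOpen_compl_iff, isOpen_iff_mem_nhds]
  rintro ⟨s, a⟩ hsa
  obtain ⟨B, hB, hBcl, hBsub⟩ := exists_mem_nhds_isClosed_subset
    ((h.isCompact_act s).isClosed.isOpen_compl.mem_nhds hsa)
  have hs : {s | (M.act s ∩ B).Nonempty}ᶜ ∈ 𝓝 s :=
    (h.isClosed_act B hBcl).isOpen_compl.mem_nhds fun ⟨b, hb, hb'⟩ => hBsub hb' hb
  filter_upwards [prod_mem_nhds hs hB] with x hx hx'
  exact hx.1 ⟨x.2, hx', hx.2⟩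

theorem isOpen_lt_extendTop {M : CMDP S A m} (hM : IsClosed {x : S × A | x.2 ∈ M.act x.1})
    {f : M.K → ℝ≥0∞} (hf : LowerSemicontinuous f) (t : ℝ≥0∞) :
    IsOpen {x | t < M.extendTop f x} := by
  rcases eq_or_ne t ⊤ with rfl | ht
  · simp
  rw [← isClosed_compl_iff, M.compl_setOf_lt_extendTop f ht]
  exact hM.isClosedEmbedding_subtypeVal.isClosedMap _ (hf.isClosed_preimage t)

variable [BorelSubspaceOfPolish S] [BorelSubspaceOfPolish A]

theorem le_liminf_pairLaw_of_isOpen {P : ProbabilityMeasure (ℕ → S × A)}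
    {Ps : ℕ → ProbabilityMeasure (ℕ → S × A)} (hPs : Tendsto Ps atTop (𝓝 P)) (n : ℕ)
    {U : Set (S × A)} (hU : IsOpen U) :
    pairLaw n P U ≤ liminf (fun k => pairLaw n (Ps k) U) atTop := by
  have := BorelSubspaceOfPolish.metrizableSpace S
  have := BorelSubspaceOfPolish.metrizableSpace A
  have hm : Measurable fun ω : ℕ → S × A => ω n := measurable_pi_apply n
  simp only [pairLaw, Measure.map_apply hm hU.measurableSet]
  exact ProbabilityMeasure.le_liminf_measure_open_of_tendsto hPs (hU.preimage (continuous_apply n))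

theorem lintegral_extendTop_le_liminf_of_isWeaklyContinuous {M : CMDP S A m}
    (hW : M.IsWeaklyContinuous) {P : ProbabilityMeasure (ℕ → S × A)}
    {Ps : ℕ → ProbabilityMeasure (ℕ → S × A)} (hPs : Tendsto Ps atTop (𝓝 P)) (n : ℕ)
    {f : M.K → ℝ≥0∞} (hfm : Measurable f) (hf : LowerSemicontinuous f) :
    ∫⁻ x, M.extendTop f x ∂(pairLaw n P) ≤
      liminf (fun k => ∫⁻ x, M.extendTop f x ∂(pairLaw n (Ps k))) atTop :=
  have := BorelSubspaceOfPolish.metrizableSpace A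
  lintegral_le_liminf_of_measure_superlevel_le (M.measurable_extendTop hfm) fun t =>
    le_liminf_pairLaw_of_isOpen hPs n (isOpen_lt_extendTop hW.isClosed_graph hf t)

theorem lintegral_extendTop_le_liminf_of_tendsto_fst {M : CMDP S A m}
    (hact : ∀ s, IsCompact (M.act s)) {P : ProbabilityMeasure (ℕ → S × A)}
    {Ps : ℕ → ProbabilityMeasure (ℕ → S × A)} (hPs : Tendsto Ps atTop (𝓝 P)) {n : ℕ}
    (hfst : ∀ D, MeasurableSet D →
      Tendsto (fun k => (pairLaw n (Ps k)).fst D) atTop (𝓝 ((pairLaw n P).fst D)))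
    {f : M.K → ℝ≥0∞} (hfm : Measurable f)
    (hf : ∀ s, LowerSemicontinuous fun a : M.act s => f ⟨(s, a.1), a.2⟩) :
    ∫⁻ x, M.extendTop f x ∂(pairLaw n P) ≤
      liminf (fun k => ∫⁻ x, M.extendTop f x ∂(pairLaw n (Ps k))) atTop := by
  have := BorelSubspaceOfPolish.metrizableSpace S
  have := BorelSubspaceOfPolish.metrizableSpace A
  have := BorelSubspaceOfPolish.standardBorelSpace A
  have := BorelSubspaceOfPolish.nonempty (Y := A)
  have hmeas := M.measurable_extendTop hfm
  exact lintegral_le_liminf_of_measure_superlevel_le hmeas fun t =>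
    le_liminf_measure_of_isOpen_section (fun U hU => le_liminf_pairLaw_of_isOpen hPs n hU) hfst
      (measurableSet_lt measurable_const hmeas)
      fun s => isOpen_section_lt_extendTop (hact s) (hf s) t

/-- In a setwise continuous model, weak convergence of strategic measures implies setwise
convergence of the laws of the states. -/
theorem tendsto_pairLaw_fst {M : CMDP S A m} (hS : M.IsSetwiseContinuous)
    {P : ProbabilityMeasure (ℕ → S × A)} (hP : P ∈ M.strategicMeasures)
    {Ps : ℕ → ProbabilityMeasure (ℕ → S × A)} (hPsm : ∀ k, Ps k ∈ M.strategicMeasures)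
    (hPs : Tendsto Ps atTop (𝓝 P)) (n : ℕ) {D : Set S} (hD : MeasurableSet D) :
    Tendsto (fun k => (pairLaw n (Ps k)).fst D) atTop (𝓝 ((pairLaw n P).fst D)) := by
  induction n generalizing D with
  | zero => simp only [pairLaw_zero_fst hP, pairLaw_zero_fst (hPsm _), tendsto_const_nhds]
  | succ n ih =>
    -- The probability of s_{n+1} ∈ E integrates p(E | ·), continuous in the action, against the law
    -- at time n, whose state marginals converge by induction. Using this for D and for its
    -- complement gives both halves of the limit.
    have hle : ∀ E, MeasurableSet E → (pairLaw (n + 1) P).fst E ≤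
        liminf (fun k => (pairLaw (n + 1) (Ps k)).fst E) atTop := fun E hE => by
      simp only [pairLaw_succ_fst hP n hE, pairLaw_succ_fst (hPsm _) n hE]
      exact lintegral_extendTop_le_liminf_of_tendsto_fst hS.isCompact_act hPs
        (fun F hF => ih hF) (M.p.measurable_coe hE)
        fun s => (hS.continuous_p s E hE).lowerSemicontinuous
    exact tendsto_measure_of_le_liminf_measure_of_limsup_measure_le subset_rfl subset_rfl
      (by simp) (hle D hD) (limsup_measure_le_of_le_liminf_measure_compl hD (hle _ hD.compl))

theorem lowerSemicontinuous_toENNReal_natCast_sub {X : Type*} [TopologicalSpace X]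
    {r : X → EReal} (hr : UpperSemicontinuous r) (l : ℕ) :
    LowerSemicontinuous fun x => ((l : EReal) - r x).toENNReal := by
  have hc : Continuous fun x : EReal => ((l : EReal) - x).toENNReal := by
    refine Continuous.ereal_toENNReal (continuous_iff_continuousAt.2 fun x => ?_)
    have h := EReal.continuousAt_add (p := ((l : EReal), -x))
      (Or.inl (EReal.coe_ne_top (l : ℝ))) (Or.inl (EReal.coe_ne_bot (l : ℝ)))
    exact ContinuousAt.comp (f := fun x : EReal => ((l : EReal), -x)) h (by fun_prop)
  exact hc.comp_upperSemicontinuous_antitone hr fun x y hxy =>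
    EReal.toENNReal_le_toENNReal (EReal.sub_le_sub le_rfl hxy)

theorem lintegral_shortfall_le_liminf {M : CMDP S A m}
    (hWS : M.IsWeaklyContinuous ∨ M.IsSetwiseContinuous)
    {P : ProbabilityMeasure (ℕ → S × A)} (hP : P ∈ M.strategicMeasures)
    {Ps : ℕ → ProbabilityMeasure (ℕ → S × A)} (hPsm : ∀ k, Ps k ∈ M.strategicMeasures)
    (hPs : Tendsto Ps atTop (𝓝 P)) (i : Fin (m + 1)) (l n : ℕ) :
    ∫⁻ x, ((l : EReal) - M.reward i x).toENNReal ∂(pairLaw n P) ≤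
      liminf (fun k => ∫⁻ x, ((l : EReal) - M.reward i x).toENNReal ∂(pairLaw n (Ps k)))
        atTop := by
  have hfm : Measurable fun k : M.K => ((l : EReal) - M.r i k).toENNReal :=
    (measurable_const.sub (M.measurable_r i)).ereal_toENNReal
  -- `reward` is 0 at infeasible pairs while `extendTop` is ∞ there; strategic measures do not see
  -- the difference.
  have heq : ∀ P' ∈ M.strategicMeasures,
      ∫⁻ x, ((l : EReal) - M.reward i x).toENNReal ∂(pairLaw n P') =
        ∫⁻ x, M.extendTop (fun k => ((l : EReal) - M.r i k).toENNReal) x ∂(pairLaw n P') :=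
    fun P' hP' => lintegral_congr_ae <| (ae_feasible hP' n).mono fun x hx => by
      dsimp only
      rw [reward, extendTop, dif_pos hx, dif_pos hx]
  simp only [heq P hP, heq _ (hPsm _)]
  rcases hWS with hW | hS
  · exact lintegral_extendTop_le_liminf_of_isWeaklyContinuous hW hPs n hfm
      (lowerSemicontinuous_toENNReal_natCast_sub (hW.usc_r i) l)
  · exact lintegral_extendTop_le_liminf_of_tendsto_fst hS.isCompact_act hPs
      (fun D hD => tendsto_pairLaw_fst hS hP hPsm hPs n hD) hfm
      fun s => lowerSemicontinuous_toENNReal_natCast_sub (hS.usc_r i s) l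

theorem shortfall_le_liminf {M : CMDP S A m}
    (hWS : M.IsWeaklyContinuous ∨ M.IsSetwiseContinuous)
    {P : ProbabilityMeasure (ℕ → S × A)} (hP : P ∈ M.strategicMeasures)
    {Ps : ℕ → ProbabilityMeasure (ℕ → S × A)} (hPsm : ∀ k, Ps k ∈ M.strategicMeasures)
    (hPs : Tendsto Ps atTop (𝓝 P)) (i : Fin (m + 1)) (l : ℕ) :
    M.shortfall i l P ≤ liminf (fun k => M.shortfall i l (Ps k)) atTop := by
  simp only [shortfall_eq_tsum]
  exact (ENNReal.tsum_le_tsum fun n => mul_le_mul_right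
    (lintegral_shortfall_le_liminf hWS hP hPsm hPs i l n) _).trans
    (ENNReal.tsum_mul_liminf_le _ _)

end Topological

end CMDP

/-! ### Upper semicontinuity of the discounted reward. -/

theorem lemma2 {S : Type u} {A : Type v}
    [TopologicalSpace S] [MeasurableSpace S] [BorelSubspaceOfPolish S]
    [TopologicalSpace A] [MeasurableSpace A] [BorelSubspaceOfPolish A]
    {m : ℕ} (M : CMDP S A m) (w : S → ℝ)
    (hA1 : M.IsUpperBound w) (hA2 : M.UniformlyIntegrable w)
    (hWS : M.IsWeaklyContinuous ∨ M.IsSetwiseContinuous) (i : Fin (m + 1)) :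
    (∀ P ∈ M.strategicMeasures, M.Jpos i P < ⊤ ∧ M.J i P < ⊤) ∧
      UpperSemicontinuousOn (M.J i) M.strategicMeasures := by
  have := BorelSubspaceOfPolish.metrizableSpace S
  have := BorelSubspaceOfPolish.metrizableSpace A
  have hpos : ∀ {P}, P ∈ M.strategicMeasures → M.Jpos i P ≠ ⊤ := fun hP =>
    (CMDP.Jpos_lt_top hA1 hA2 i hP).ne
  have hJ : ∀ {P}, P ∈ M.strategicMeasures → M.J i P = (M.Jpos i P : EReal) - M.Jneg i P :=
    fun hP => M.J_eq_Jpos_sub_Jneg i _ (hpos hP)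
  refine ⟨fun P hP => ⟨(hpos hP).lt_top, ?_⟩, fun P hP c hc => ?_⟩
  · rw [hJ hP]
    refine (EReal.sub_le_sub le_rfl (EReal.coe_ennreal_nonneg _)).trans_lt ?_
    simpa [lt_top_iff_ne_top] using hpos hP
  by_contra hcon
  -- Sequences suffice because the weak topology is metrizable here.
  obtain ⟨Ps, hPs, hPsJ⟩ := exists_seq_forall_of_frequently
    ((not_eventually.1 hcon).and_eventually self_mem_nhdsWithin)
  have hPsm : ∀ k, Ps k ∈ M.strategicMeasures := fun k => (hPsJ k).2
  -- With J(P) < c₁ < c₂ < c ≤ J(Ps k), the gap c₂ - c₁ is the room left for the excess. The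
  -- shortfalls along the sequence are then at most L - c₁, hence so is that of P, which forces J(P)
  -- ≥ c₁.
  obtain ⟨c₁, hc₁, hc₁'⟩ := EReal.lt_iff_exists_real_btwn.1 hc
  obtain ⟨c₂, hc₂, hc₂'⟩ := EReal.lt_iff_exists_real_btwn.1 hc₁'
  have hlt : c₁ < c₂ := EReal.coe_lt_coe_iff.1 hc₂
  obtain ⟨l, hl⟩ := hA2.exists_excess_le hA1 i
    (ε := ENNReal.ofReal (c₂ - c₁)) (by simpa using hlt)
  have hL : (∑' n : ℕ, ENNReal.ofReal (M.β ^ n)) * l ≠ ⊤ :=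
    ENNReal.mul_ne_top M.tsum_discount_ne_top (by simp)
  have hbound := fun k => EReal.le_ofReal_of_le_coe_sub (hpos (hPsm k)) hL
    (M.Jpos_add_shortfall i l (Ps k)) (hl _ (hPsm k)) hlt.le
    (by rw [← hJ (hPsm k)]; exact hc₂'.le.trans (not_lt.1 (hPsJ k).1))
  have hshort : M.shortfall i l P ≤
      ENNReal.ofReal (((∑' n : ℕ, ENNReal.ofReal (M.β ^ n)) * l).toReal - c₁) :=
    (CMDP.shortfall_le_liminf hWS hP hPsm (hPs.mono_right nhdsWithin_le_nhds) i l).trans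
      ((liminf_le_liminf (Eventually.of_forall fun k => (hbound k).2)).trans
        (liminf_const _).le)
  refine absurd hc₁ (not_lt.2 ?_)
  rw [hJ hP]
  exact EReal.coe_le_coe_sub_of_le_ofReal (hpos hP) hL (M.Jpos_add_shortfall i l P)
    (hbound 0).1 hshort
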